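/- An (abstract) operator space is a complex normed space $V$ together with norms on all matrix spaces $M_n(V)$, extending the norm of $V=M_1(V)$, such that $\|v\oplus w\|=\max\{\|v\|,\|w\|\}$ and $\|\alpha v\beta\|\le\|\alpha\|\,\|v\|\,\|\beta\|$ for matrices $v,w$ over $V$ and scalar matrices $\alpha,\beta$ (with the operator norm) of matching sizes. For a linear map $T:V\to W$ between operator spaces, $\|T\|_{\mathrm{cb}}=\sup_n\|T_n:M_n(V)\to M_n(W)\|$, where $T_n$ applies $T$ entrywise, and $\mathcal{CB}(V,W)$ is the space of all $T$ with $\|T\|_{\mathrm{cb}}<\infty$. Subspaces, quotients by closed subspaces, and duals of operator spaces carry their usual operator space structures: $M_n(Y)\subset M_n(V)$, $M_n(V/Y)=M_n(V)/M_n(Y)$, $M_n(V^*)=\mathcal{CB}(V,M_n)$. An operator space $Z$ is injective if, for all operator spaces $B\subset A$, every $\varphi\in\mathcal{CB}(B,Z)$ has an extension $\psi\in\mathcal{CB}(A,Z)$ with $\|\psi\|_{\mathrm{cb}}=\|\varphi\|_{\mathrm{cb}}$. Proposition. Let $E$ and $F$ be operator spaces such that $E^*$ and $F^*$ are injective, and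 let $T\in\mathcal{CB}(E,F^*)$. Then the following are equivalent: (i) $T$ is completely compact, i.e., for each $\epsilon>0$ there is a finite-dimensional subspace $Y_\epsilon$ of $F^*$ such that $\|Q_{Y_\epsilon}T\|_{\mathrm{cb}}<\epsilon$, where $Q_{Y_\epsilon}:F^*\to F^*/Y_\epsilon$ is the quotient map; (ii) $T$ is Gelfand completely compact, i.e., for each $\epsilon>0$ there is a closed subspace $X_\epsilon$ of $E$ of finite codimension such that $\|T|_{X_\epsilon}\|_{\mathrm{cb}}<\epsilon$; (iii) $T$ is a limit in the cb-norm of a sequence of finite rank operators in $\mathcal{CB}(E,F^*)$. -/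

import Mathlib

open scoped Matrix.Norms.L2Operator ENNReal Topology Matrix Kronecker

universe u

/-- The product `α v β` of an `n × m` scalar matrix, an `m × m` matrix over `V`, and an `m × n`
scalar matrix. -/
def matAct {V : Type*} [AddCommGroup V] [Module ℂ V] {m n : ℕ}
    (α : Matrix (Fin n) (Fin m) ℂ) (v : Matrix (Fin m) (Fin m) V) (β : Matrix (Fin m) (Fin n) ℂ) :
    Matrix (Fin n) (Fin n) V :=
  Matrix.of fun i j => ∑ k, ∑ l, (α i k * β l j) • v k l

/-- The direct sum `v ⊕ w`, a block diagonal matrix of size `m + n`. -/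
def matDirectSum {V : Type*} [AddCommGroup V] {m n : ℕ}
    (v : Matrix (Fin m) (Fin m) V) (w : Matrix (Fin n) (Fin n) V) :
    Matrix (Fin (m + n)) (Fin (m + n)) V :=
  (Matrix.fromBlocks v 0 0 w).submatrix finSumFinEquiv.symm finSumFinEquiv.symm

/-- An (abstract) operator space: a complex normed space `V` with a norm on each matrix space
`M_n(V)`, extending the norm of `V = M_1(V)` and satisfying Ruan's axioms
`‖v ⊕ w‖ = max ‖v‖ ‖w‖` and `‖α v β‖ ≤ ‖α‖ ‖v‖ ‖β‖`, where scalar matrices carry the operator norm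
between Euclidean spaces. In the first axiom `≤` is enough, see `matNorm_matDirectSum`; that the
seminorms are norms is automatic, see `eq_zero_of_matNorm_eq_zero`. -/
class OperatorSpace (V : Type*) [NormedAddCommGroup V] [NormedSpace ℂ V] where
  matNorm : (n : ℕ) → Seminorm ℂ (Matrix (Fin n) (Fin n) V)
  matNorm_one : ∀ v : V, matNorm 1 (Matrix.of fun _ _ => v) = ‖v‖
  matNorm_matDirectSum_le : ∀ {m n : ℕ} (v : Matrix (Fin m) (Fin m) V)
    (w : Matrix (Fin n) (Fin n) V),
    matNorm (m + n) (matDirectSum v w) ≤ max (matNorm m v) (matNorm n w)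
  matNorm_matAct_le : ∀ {m n : ℕ} (α : Matrix (Fin n) (Fin m) ℂ) (v : Matrix (Fin m) (Fin m) V)
    (β : Matrix (Fin m) (Fin n) ℂ), matNorm n (matAct α v β) ≤ ‖α‖ * matNorm m v * ‖β‖

namespace OperatorSpace

section ScalarMatrices

set_option linter.unusedSectionVars false

variable {m n p : Type*} [Fintype m] [Fintype n] [Fintype p] [DecidableEq m] [DecidableEq n]
  [DecidableEq p]

theorem l2_le {A : Matrix m n ℂ} {C : ℝ} (hC : 0 ≤ C)
    (h : ∀ v : n → ℂ, ∑ i, ‖(A *ᵥ v) i‖ ^ 2 ≤ C ^ 2 * ∑ j, ‖v j‖ ^ 2) : ‖A‖ ≤ C := by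
  rw [Matrix.l2_opNorm_def]
  refine ContinuousLinearMap.opNorm_le_bound _ hC fun x => ?_
  refine abs_le_of_sq_le_sq' ?_ (by positivity) |>.2
  rw [mul_pow, EuclideanSpace.norm_sq_eq, EuclideanSpace.norm_sq_eq]
  exact h x.ofLp

theorem l2_sum_le (A : Matrix m n ℂ) (v : n → ℂ) :
    ∑ i, ‖(A *ᵥ v) i‖ ^ 2 ≤ ‖A‖ ^ 2 * ∑ j, ‖v j‖ ^ 2 := by
  have := Matrix.l2_opNorm_mulVec A (WithLp.toLp 2 v)
  have h2 := pow_le_pow_left₀ (norm_nonneg _) this 2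
  rw [mul_pow, EuclideanSpace.norm_sq_eq, EuclideanSpace.norm_sq_eq] at h2
  exact h2

theorem norm_kronecker_one_le (A : Matrix m n ℂ) : ‖A ⊗ₖ (1 : Matrix p p ℂ)‖ ≤ ‖A‖ := by
  refine l2_le (norm_nonneg _) fun v => ?_
  have key : ∀ (i : m) (l : p), ((A ⊗ₖ (1 : Matrix p p ℂ)) *ᵥ v) (i, l)
      = (A *ᵥ fun k => v (k, l)) i := by
    intro i l
    simp [Matrix.mulVec, dotProduct, Fintype.sum_prod_type, Matrix.kroneckerMap_apply,
      Matrix.one_apply]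
  rw [Fintype.sum_prod_type, Fintype.sum_prod_type, Finset.sum_comm, Finset.sum_comm (γ := n),
    Finset.mul_sum]
  refine Finset.sum_le_sum fun l _ => ?_
  simp only [key]
  exact l2_sum_le A fun k => v (k, l)

theorem norm_one_kronecker_le (A : Matrix m n ℂ) : ‖(1 : Matrix p p ℂ) ⊗ₖ A‖ ≤ ‖A‖ := by
  refine l2_le (norm_nonneg _) fun v => ?_
  have key : ∀ (l : p) (i : m), (((1 : Matrix p p ℂ) ⊗ₖ A) *ᵥ v) (l, i)
      = (A *ᵥ fun k => v (l, k)) i := by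
    intro l i
    simp [Matrix.mulVec, dotProduct, Fintype.sum_prod_type, Matrix.kroneckerMap_apply,
      Matrix.one_apply]
  rw [Fintype.sum_prod_type, Fintype.sum_prod_type, Finset.mul_sum]
  refine Finset.sum_le_sum fun l _ => ?_
  simp only [key]
  exact l2_sum_le A fun k => v (l, k)

theorem norm_col_le (v : n → ℂ) :
    ‖(Matrix.of fun (i : n) (_ : Fin 1) => v i)‖ ≤ √(∑ i, ‖v i‖ ^ 2) := by
  refine l2_le (Real.sqrt_nonneg _) fun w => ?_
  rw [Real.sq_sqrt (by positivity)]
  simp [Matrix.mulVec, dotProduct, mul_pow, Finset.sum_mul]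

theorem norm_row_le (v : n → ℂ) :
    ‖(Matrix.of fun (_ : Fin 1) (i : n) => star (v i))‖ ≤ √(∑ i, ‖v i‖ ^ 2) := by
  rw [← Matrix.l2_opNorm_conjTranspose]
  convert norm_col_le v using 2
  ext i j
  simp [Matrix.conjTranspose_apply]

theorem norm_entry_le_l2 (A : Matrix m n ℂ) (i : m) (j : n) : ‖A i j‖ ≤ ‖A‖ := by
  have h := l2_sum_le A (Pi.single j 1)
  have h1 : ‖A i j‖ ^ 2 ≤ ∑ i, ‖(A *ᵥ Pi.single j 1) i‖ ^ 2 := by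
    have := Finset.single_le_sum (f := fun i => ‖(A *ᵥ Pi.single j 1) i‖ ^ 2)
      (fun _ _ => by positivity) (Finset.mem_univ i)
    simpa using this
  have h2 : ∑ k, ‖(Pi.single j 1 : n → ℂ) k‖ ^ 2 = 1 := by simp [Pi.single_apply, apply_ite]
  rw [h2, mul_one] at h
  exact abs_le_of_sq_le_sq' (h1.trans h) (norm_nonneg _) |>.2

theorem norm_le_one_of_conjTranspose_mul {A : Matrix m n ℂ} (h : Aᴴ * A = 1) : ‖A‖ ≤ 1 := by
  have h1 := Matrix.l2_opNorm_conjTranspose_mul_self A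
  have h2 : ‖(1 : Matrix n n ℂ)‖ ≤ 1 := l2_le zero_le_one fun v => by simp
  rw [h] at h1
  nlinarith [norm_nonneg A]

theorem norm_le_one_of_mul_conjTranspose {A : Matrix m n ℂ} (h : A * Aᴴ = 1) : ‖A‖ ≤ 1 := by
  rw [← Matrix.l2_opNorm_conjTranspose]
  exact norm_le_one_of_conjTranspose_mul (by simpa using h)

end ScalarMatrices

section Basic

variable {V : Type*} [NormedAddCommGroup V] [NormedSpace ℂ V] [OperatorSpace V]

theorem norm_entry_le {n : ℕ} (v : Matrix (Fin n) (Fin n) V) (i j : Fin n) :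
    ‖v i j‖ ≤ matNorm n v := by
  let R : Matrix (Fin 1) (Fin n) ℂ := Matrix.of fun _ k => star ((Pi.single i 1 : Fin n → ℂ) k)
  let K : Matrix (Fin n) (Fin 1) ℂ := Matrix.of fun k _ => (Pi.single j 1 : Fin n → ℂ) k
  have h := matNorm_matAct_le R v K
  have e : matAct R v K = Matrix.of fun _ _ => v i j := by
    ext a b
    simp [matAct, R, K, Pi.single_apply, apply_ite]
  rw [e, matNorm_one] at h
  have h1 : ∀ i : Fin n, √(∑ k, ‖(Pi.single i 1 : Fin n → ℂ) k‖ ^ 2) = 1 := by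
    intro i
    simp [Pi.single_apply, apply_ite]
  have hr : ‖R‖ ≤ _ := norm_row_le (Pi.single i 1 : Fin n → ℂ)
  have hc : ‖K‖ ≤ _ := norm_col_le (Pi.single j 1 : Fin n → ℂ)
  rw [h1] at hr hc
  refine h.trans ?_
  have h0 : 0 ≤ matNorm n v := apply_nonneg _ _
  calc _ ≤ 1 * matNorm n v * 1 := by gcongr
    _ = _ := by ring

theorem eq_zero_of_matNorm_eq_zero {n : ℕ} {v : Matrix (Fin n) (Fin n) V}
    (h : matNorm n v = 0) : v = 0 := by
  ext i j
  have := norm_entry_le v i j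
  rw [h] at this
  simpa using this

theorem matNorm_matDirectSum {m n : ℕ} (v : Matrix (Fin m) (Fin m) V)
    (w : Matrix (Fin n) (Fin n) V) :
    matNorm (m + n) (matDirectSum v w) = max (matNorm m v) (matNorm n w) := by
  refine le_antisymm (matNorm_matDirectSum_le v w) (max_le ?_ ?_)
  · let α : Matrix (Fin m) (Fin (m + n)) ℂ := Matrix.of fun i k => if k = Fin.castAdd n i then 1 else 0
    have hα : ‖α‖ ≤ 1 := norm_le_one_of_mul_conjTranspose (by
      ext i j
      simp [α, Matrix.mul_apply, Matrix.one_apply, eq_comm])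
    have e : matAct α (matDirectSum v w) αᴴ = v := by
      ext i j
      simp [matAct, α, matDirectSum, apply_ite]
    have h := matNorm_matAct_le α (matDirectSum v w) αᴴ
    rw [e, Matrix.l2_opNorm_conjTranspose] at h
    have h0 : 0 ≤ matNorm _ (matDirectSum v w) := apply_nonneg _ _
    calc _ ≤ _ := h
      _ ≤ 1 * matNorm _ (matDirectSum v w) * 1 := by gcongr
      _ = _ := by ring
  · let α : Matrix (Fin n) (Fin (m + n)) ℂ := Matrix.of fun i k => if k = Fin.natAdd m i then 1 else 0
    have hα : ‖α‖ ≤ 1 := norm_le_one_of_mul_conjTranspose (by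
      ext i j
      simp [α, Matrix.mul_apply, Matrix.one_apply, eq_comm])
    have e : matAct α (matDirectSum v w) αᴴ = w := by
      ext i j
      simp [matAct, α, matDirectSum, apply_ite]
    have h := matNorm_matAct_le α (matDirectSum v w) αᴴ
    rw [e, Matrix.l2_opNorm_conjTranspose] at h
    have h0 : 0 ≤ matNorm _ (matDirectSum v w) := apply_nonneg _ _
    calc _ ≤ _ := h
      _ ≤ 1 * matNorm _ (matDirectSum v w) * 1 := by gcongr
      _ = _ := by ring

theorem norm_map_functional_le (f : StrongDual ℂ V) {n : ℕ} (x : Matrix (Fin n) (Fin n) V) :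
    ‖x.map f‖ ≤ ‖f‖ * matNorm n x := by
  have h0 : 0 ≤ matNorm n x := apply_nonneg _ _
  refine l2_le (by positivity) fun ξ => ?_
  set η : Fin n → ℂ := x.map f *ᵥ ξ with hη
  set a := √(∑ i, ‖η i‖ ^ 2) with ha
  set b := √(∑ i, ‖ξ i‖ ^ 2) with hb
  have ha2 : a ^ 2 = ∑ i, ‖η i‖ ^ 2 := Real.sq_sqrt (by positivity)
  have hb2 : b ^ 2 = ∑ i, ‖ξ i‖ ^ 2 := Real.sq_sqrt (by positivity)
  have ha0 : 0 ≤ a := Real.sqrt_nonneg _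
  have hb0 : 0 ≤ b := Real.sqrt_nonneg _
  rw [← ha2, ← hb2, ← mul_pow]
  let R : Matrix (Fin 1) (Fin n) ℂ := Matrix.of fun _ i => star (η i)
  let K : Matrix (Fin n) (Fin 1) ℂ := Matrix.of fun i _ => ξ i
  let z : V := ∑ i, ∑ j, (star (η i) * ξ j) • x i j
  have hz : ‖z‖ ≤ a * matNorm n x * b := by
    have h := matNorm_matAct_le R x K
    have e : matAct R x K = Matrix.of fun _ _ => z := rfl
    rw [e, matNorm_one] at h
    refine h.trans ?_
    have hR : ‖R‖ ≤ a := norm_row_le η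
    have hK : ‖K‖ ≤ b := norm_col_le ξ
    gcongr
  have hfz : f z = ((a ^ 2 : ℝ) : ℂ) := by
    rw [ha2]
    simp only [z, map_sum, map_smul, smul_eq_mul]
    push_cast
    refine Finset.sum_congr rfl fun i _ => ?_
    have : η i = ∑ j, f (x i j) * ξ j := rfl
    rw [← Complex.conj_mul', starRingEnd_apply]
    calc ∑ j, star (η i) * ξ j * f (x i j) = star (η i) * ∑ j, f (x i j) * ξ j := by
          rw [Finset.mul_sum]
          exact Finset.sum_congr rfl fun j _ => by ring
      _ = _ := by rw [← this]
  have h1 : a ^ 2 ≤ ‖f‖ * (a * matNorm n x * b) := by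
    calc a ^ 2 = ‖f z‖ := by rw [hfz, Complex.norm_real, Real.norm_of_nonneg (by positivity)]
      _ ≤ ‖f‖ * ‖z‖ := f.le_opNorm z
      _ ≤ _ := by gcongr
  rcases ha0.eq_or_lt with h | h
  · rw [← h]; simp; positivity
  · have : a ≤ ‖f‖ * matNorm n x * b := by
      refine le_of_mul_le_mul_left ?_ h
      nlinarith
    gcongr

end Basic

section Constructions

variable {V : Type*} [NormedAddCommGroup V] [NormedSpace ℂ V] [OperatorSpace V]

/-- A subspace of an operator space, with the matrix norms of the ambient space. -/
noncomputable instance instSubmodule (Y : Submodule ℂ V) : OperatorSpace Y where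
  matNorm n := (matNorm (V := V) n).comp Y.subtype.mapMatrix
  matNorm_one v := (matNorm_one (v : V) :)
  matNorm_matDirectSum_le v w := by
    simp only [Seminorm.comp_apply]
    refine le_trans (le_of_eq ?_) (matNorm_matDirectSum_le _ _)
    congr 1
    simp only [matDirectSum, LinearMap.mapMatrix_apply, ← Matrix.submatrix_map,
      Matrix.fromBlocks_map]
    congr 2
  matNorm_matAct_le α v β := by
    simp only [Seminorm.comp_apply]
    refine le_trans (le_of_eq ?_) (matNorm_matAct_le _ _ _)
    congr 1
    ext i j
    simp [matAct]

/-- The quotient norm of `x ∈ M_n(V/Y) = M_n(V)/M_n(Y)`. -/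
noncomputable def quotMatNorm (Y : Submodule ℂ V) (n : ℕ) (x : Matrix (Fin n) (Fin n) (V ⧸ Y)) : ℝ :=
  sInf (matNorm n '' {y : Matrix (Fin n) (Fin n) V | y.map Y.mkQ = x})

theorem quotMatNorm_le (Y : Submodule ℂ V) {n : ℕ} (y : Matrix (Fin n) (Fin n) V) :
    quotMatNorm Y n (y.map Y.mkQ) ≤ matNorm n y :=
  csInf_le ⟨0, by rintro _ ⟨y, -, rfl⟩; exact apply_nonneg _ _⟩ ⟨y, rfl, rfl⟩

theorem exists_lift_lt (Y : Submodule ℂ V) {n : ℕ} (x : Matrix (Fin n) (Fin n) (V ⧸ Y)) {ε : ℝ}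
    (hε : 0 < ε) : ∃ y : Matrix (Fin n) (Fin n) V, y.map Y.mkQ = x ∧
      matNorm n y < quotMatNorm Y n x + ε := by
  have hne : (matNorm n '' {y : Matrix (Fin n) (Fin n) V | y.map Y.mkQ = x}).Nonempty := by
    refine ⟨_, x.map (Function.surjInv Y.mkQ_surjective), ?_, rfl⟩
    ext i j
    exact Function.surjInv_eq Y.mkQ_surjective _
  obtain ⟨_, ⟨y, hy, rfl⟩, hlt⟩ := exists_lt_of_csInf_lt hne (lt_add_of_pos_right _ hε)
  exact ⟨y, hy, hlt⟩

theorem quotMatNorm_nonneg (Y : Submodule ℂ V) {n : ℕ} (x : Matrix (Fin n) (Fin n) (V ⧸ Y)) :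
    0 ≤ quotMatNorm Y n x :=
  Real.sInf_nonneg (by rintro _ ⟨y, -, rfl⟩; exact apply_nonneg _ _)

/-- The quotient of an operator space by a closed subspace. -/
noncomputable instance instQuotient (Y : Submodule ℂ V) [IsClosed (Y : Set V)] :
    OperatorSpace (V ⧸ Y) where
  matNorm n := Seminorm.ofSMulLE (quotMatNorm Y n)
    (le_antisymm (by
      have := quotMatNorm_le Y (0 : Matrix (Fin n) (Fin n) V)
      rwa [map_zero, Matrix.map_zero _ (map_zero _)] at this) (quotMatNorm_nonneg Y _))
    (fun x x' => by
      refine le_of_forall_pos_le_add fun ε hε => ?_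
      obtain ⟨y, rfl, hy⟩ := exists_lift_lt Y x (half_pos hε)
      obtain ⟨y', rfl, hy'⟩ := exists_lift_lt Y x' (half_pos hε)
      rw [← Matrix.map_add _ (map_add _)]
      have := quotMatNorm_le Y (y + y')
      have := map_add_le_add (matNorm n) y y'
      linarith)
    (fun r x => by
      refine le_of_forall_pos_le_add fun ε hε => ?_
      obtain ⟨y, rfl, hy⟩ := exists_lift_lt Y x (ε := ε / (‖r‖ + 1)) (by positivity)
      rw [← Matrix.map_smul _ _ (fun _ => map_smul _ _ _)]
      refine (quotMatNorm_le Y (r • y)).trans ?_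
      rw [map_smul_eq_mul]
      have h2 : ‖r‖ * (ε / (‖r‖ + 1)) ≤ ε := by
        rw [mul_div_assoc', div_le_iff₀ (by positivity)]
        nlinarith [norm_nonneg r]
      nlinarith [norm_nonneg r])
  matNorm_one v := by
    change quotMatNorm Y 1 _ = _
    refine le_antisymm ?_ ?_
    · refine le_of_forall_pos_le_add fun ε hε => ?_
      obtain ⟨y, rfl, hy⟩ := Submodule.Quotient.norm_mk_lt (S := Y) v hε
      refine le_trans ?_ hy.le
      rw [← matNorm_one y]
      exact quotMatNorm_le Y (Matrix.of fun _ _ => y)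
    · refine le_of_forall_pos_le_add fun ε hε => ?_
      obtain ⟨y, hy, hlt⟩ := exists_lift_lt Y (Matrix.of fun (_ _ : Fin 1) => v) hε
      have hv : Y.mkQ (y 0 0) = v := congrFun (congrFun hy 0) 0
      rw [← hv] at hlt ⊢
      exact ((Submodule.Quotient.norm_mk_le Y (y 0 0)).trans (norm_entry_le y 0 0)).trans hlt.le
  matNorm_matDirectSum_le {m n} v w := by
    change quotMatNorm Y _ _ ≤ max (quotMatNorm Y _ _) (quotMatNorm Y _ _)
    refine le_of_forall_pos_le_add fun ε hε => ?_
    obtain ⟨y, rfl, hy⟩ := exists_lift_lt Y v hε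
    obtain ⟨z, rfl, hz⟩ := exists_lift_lt Y w hε
    have e : matDirectSum (y.map Y.mkQ) (z.map Y.mkQ) = (matDirectSum y z).map Y.mkQ := by
      simp only [matDirectSum, ← Matrix.submatrix_map, Matrix.fromBlocks_map]
      congr 2
    rw [e, ← max_add_add_right]
    exact (quotMatNorm_le Y _).trans ((matNorm_matDirectSum_le y z).trans
      (max_le_max hy.le hz.le))
  matNorm_matAct_le {m n} α v β := by
    change quotMatNorm Y _ _ ≤ _ * quotMatNorm Y _ _ * _
    refine le_of_forall_pos_le_add fun ε hε => ?_
    obtain ⟨y, rfl, hy⟩ := exists_lift_lt Y v (ε := ε / (‖α‖ * ‖β‖ + 1)) (by positivity)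
    have e : matAct α (y.map Y.mkQ) β = (matAct α y β).map Y.mkQ := by
      ext i j
      simp [matAct]
    rw [e]
    refine (quotMatNorm_le Y _).trans ((matNorm_matAct_le α y β).trans ?_)
    have h2 : (‖α‖ * ‖β‖) * (ε / (‖α‖ * ‖β‖ + 1)) ≤ ε := by
      rw [mul_div_assoc', div_le_iff₀ (by positivity)]
      nlinarith [mul_nonneg (norm_nonneg α) (norm_nonneg β)]
    nlinarith [mul_nonneg (norm_nonneg α) (norm_nonneg β)]

/-- The scalar matrix `[f_ij(x_kl)]`, for a matrix `f` of functionals and a matrix `x` of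
vectors. -/
noncomputable def matPairing {n m : ℕ} (f : Matrix (Fin n) (Fin n) (StrongDual ℂ V))
    (x : Matrix (Fin m) (Fin m) V) : Matrix (Fin n × Fin m) (Fin n × Fin m) ℂ :=
  Matrix.of fun p q => f p.1 q.1 (x p.2 q.2)

/-- The norm on `M_n(V*) = CB(V, M_n)`: the supremum of `‖[f_ij(x_kl)]‖` over all matrices `x` over
`V`, of any size, with `‖x‖ ≤ 1`. -/
noncomputable def dualMatNorm (n : ℕ) (f : Matrix (Fin n) (Fin n) (StrongDual ℂ V)) : ℝ :=
  sSup {r : ℝ | ∃ (m : ℕ) (x : Matrix (Fin m) (Fin m) V), matNorm m x ≤ 1 ∧ r = ‖matPairing f x‖}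

theorem exists_matPairing_bound {n : ℕ} (f : Matrix (Fin n) (Fin n) (StrongDual ℂ V)) :
    ∃ C : ℝ, ∀ (m : ℕ) (x : Matrix (Fin m) (Fin m) V),
      ‖matPairing f x‖ ≤ C * matNorm m x := by
  refine ⟨∑ i, ∑ j, ‖Matrix.single i j (1 : ℂ)‖ * ‖f i j‖, fun m x => ?_⟩
  have e : matPairing f x = ∑ i, ∑ j, (Matrix.single i j (1 : ℂ) ⊗ₖ (1 : Matrix (Fin m) (Fin m) ℂ))
      * ((1 : Matrix (Fin n) (Fin n) ℂ) ⊗ₖ x.map (f i j)) := by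
    simp only [← Matrix.mul_kronecker_mul, mul_one, one_mul]
    ext ⟨a, k⟩ ⟨b, l⟩
    simp [matPairing, Matrix.sum_apply, Matrix.single_apply, ite_and]
  rw [e, Finset.sum_mul]
  refine (norm_sum_le _ _).trans (Finset.sum_le_sum fun i _ => ?_)
  rw [Finset.sum_mul]
  refine (norm_sum_le _ _).trans (Finset.sum_le_sum fun j _ => ?_)
  refine (Matrix.l2_opNorm_mul _ _).trans ?_
  rw [mul_assoc]
  exact mul_le_mul (norm_kronecker_one_le _)
    ((norm_one_kronecker_le _).trans (norm_map_functional_le (f i j) x)) (norm_nonneg _)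
    (norm_nonneg _)

theorem norm_matPairing_le_of_le_one {n m : ℕ} (f : Matrix (Fin n) (Fin n) (StrongDual ℂ V))
    {x : Matrix (Fin m) (Fin m) V} (hx : matNorm m x ≤ 1) :
    ‖matPairing f x‖ ≤ dualMatNorm n f := by
  refine le_csSup ?_ ⟨m, x, hx, rfl⟩
  obtain ⟨C, hC⟩ := exists_matPairing_bound f
  refine ⟨|C|, ?_⟩
  rintro _ ⟨k, y, hy, rfl⟩
  have h0 : 0 ≤ matNorm k y := apply_nonneg _ _
  calc _ ≤ C * matNorm k y := hC k y
    _ ≤ |C| * matNorm k y := by gcongr; exact le_abs_self C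
    _ ≤ |C| * 1 := by gcongr
    _ = _ := mul_one _

theorem dualMatNorm_le {n : ℕ} (f : Matrix (Fin n) (Fin n) (StrongDual ℂ V)) {C : ℝ}
    (h : ∀ (m : ℕ) (x : Matrix (Fin m) (Fin m) V), matNorm m x ≤ 1 → ‖matPairing f x‖ ≤ C) :
    dualMatNorm n f ≤ C := by
  refine csSup_le ⟨_, 0, 0, by simp, rfl⟩ ?_
  rintro _ ⟨m, x, hx, rfl⟩
  exact h m x hx

theorem dualMatNorm_nonneg {n : ℕ} (f : Matrix (Fin n) (Fin n) (StrongDual ℂ V)) :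
    0 ≤ dualMatNorm n f :=
  (norm_nonneg _).trans (norm_matPairing_le_of_le_one f (m := 0) (x := 0) (by simp))

/-- The norm of `M_n(V*)` as a seminorm. -/
noncomputable def dualMatSeminorm (V : Type*) [NormedAddCommGroup V] [NormedSpace ℂ V]
    [OperatorSpace V] (n : ℕ) : Seminorm ℂ (Matrix (Fin n) (Fin n) (StrongDual ℂ V)) :=
  Seminorm.ofSMulLE (𝕜 := ℂ) (dualMatNorm n)
    (le_antisymm (dualMatNorm_le _ fun m x _ => by
      have : matPairing (0 : Matrix (Fin n) (Fin n) (StrongDual ℂ V)) x = 0 := by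
        ext; simp [matPairing]
      simp [this]) (dualMatNorm_nonneg _))
    (fun f g => dualMatNorm_le _ fun m x hx => by
      have : matPairing (f + g) x = matPairing f x + matPairing g x := by
        ext; simp [matPairing]
      rw [this]
      exact (norm_add_le _ _).trans (add_le_add (norm_matPairing_le_of_le_one f hx)
        (norm_matPairing_le_of_le_one g hx)))
    (fun (r : ℂ) f => dualMatNorm_le _ fun m x hx => by
      have : matPairing (r • f) x = r • matPairing f x := by
        ext; simp [matPairing]
      rw [this, norm_smul]
      gcongr
      exact norm_matPairing_le_of_le_one f hx)

/-- The dual operator space `V*`, with `M_n(V*) = CB(V, M_n)`. -/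
noncomputable instance instDual : OperatorSpace (StrongDual ℂ V) where
  matNorm n := dualMatSeminorm V n
  matNorm_one f := by
    change dualMatNorm 1 _ = _
    have hp : ∀ (m : ℕ) (x : Matrix (Fin m) (Fin m) V),
        matPairing (Matrix.of fun (_ _ : Fin 1) => f) x = (1 : Matrix (Fin 1) (Fin 1) ℂ) ⊗ₖ x.map f := by
      intro m x
      ext ⟨a, k⟩ ⟨b, l⟩
      simp [matPairing, Subsingleton.elim a b]
    refine le_antisymm (dualMatNorm_le _ fun m x hx => ?_) ?_
    · rw [hp]
      refine (norm_one_kronecker_le _).trans ((norm_map_functional_le f x).trans ?_)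
      exact mul_le_of_le_one_right (norm_nonneg _) hx
    · refine f.opNorm_le_bound (dualMatNorm_nonneg _) fun v => ?_
      rcases eq_or_ne v 0 with rfl | hv
      · simp
      have hv' : 0 < ‖v‖ := norm_pos_iff.mpr hv
      let x : Matrix (Fin 1) (Fin 1) V := Matrix.of fun _ _ => ((‖v‖⁻¹ : ℝ) : ℂ) • v
      have hx : matNorm 1 x ≤ 1 := by
        rw [matNorm_one (((‖v‖⁻¹ : ℝ) : ℂ) • v), norm_smul, Complex.norm_real, norm_inv, norm_norm,
          inv_mul_cancel₀ hv'.ne']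
      have h := norm_matPairing_le_of_le_one (Matrix.of fun (_ _ : Fin 1) => f) hx
      have h2 := (norm_entry_le_l2 (matPairing (Matrix.of fun (_ _ : Fin 1) => f) x)
        (0, 0) (0, 0)).trans h
      simp only [matPairing, Matrix.of_apply, x, map_smul, norm_smul, Complex.norm_real, norm_inv,
        norm_norm] at h2
      rwa [inv_mul_le_iff₀ hv', mul_comm] at h2
  matNorm_matDirectSum_le {m n} f g := by
    change dualMatNorm _ _ ≤ max (dualMatNorm _ _) (dualMatNorm _ _)
    refine dualMatNorm_le _ fun k x hx => ?_
    have hf := (norm_matPairing_le_of_le_one f hx).trans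
      (le_max_left (dualMatNorm m f) (dualMatNorm n g))
    have hg := (norm_matPairing_le_of_le_one g hx).trans
      (le_max_right (dualMatNorm m f) (dualMatNorm n g))
    have h0 : 0 ≤ max (dualMatNorm m f) (dualMatNorm n g) := (norm_nonneg _).trans hf
    refine l2_le h0 fun v => ?_
    have k1 : ∀ (i : Fin m) (l : Fin k), (matPairing (matDirectSum f g) x *ᵥ v) (Fin.castAdd n i, l)
        = (matPairing f x *ᵥ fun q => v (Fin.castAdd n q.1, q.2)) (i, l) := by
      intro i l
      simp [Matrix.mulVec, dotProduct, Fintype.sum_prod_type, Fin.sum_univ_add, matPairing,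
        matDirectSum]
    have k2 : ∀ (i : Fin n) (l : Fin k), (matPairing (matDirectSum f g) x *ᵥ v) (Fin.natAdd m i, l)
        = (matPairing g x *ᵥ fun q => v (Fin.natAdd m q.1, q.2)) (i, l) := by
      intro i l
      simp [Matrix.mulVec, dotProduct, Fintype.sum_prod_type, Fin.sum_univ_add, matPairing,
        matDirectSum]
    have s1 := l2_sum_le (matPairing f x) fun q => v (Fin.castAdd n q.1, q.2)
    have s2 := l2_sum_le (matPairing g x) fun q => v (Fin.natAdd m q.1, q.2)
    rw [Fintype.sum_prod_type, Fintype.sum_prod_type] at s1 s2 ⊢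
    rw [Fin.sum_univ_add, Fin.sum_univ_add, mul_add]
    simp only [k1, k2]
    refine add_le_add (s1.trans ?_) (s2.trans ?_) <;> gcongr
  matNorm_matAct_le {m n} α f β := by
    change dualMatNorm _ _ ≤ _ * dualMatNorm _ _ * _
    refine dualMatNorm_le _ fun k x hx => ?_
    have e : matPairing (matAct α f β) x = (α ⊗ₖ (1 : Matrix (Fin k) (Fin k) ℂ)) * matPairing f x
        * (β ⊗ₖ (1 : Matrix (Fin k) (Fin k) ℂ)) := by
      ext ⟨a, c⟩ ⟨b, d⟩
      simp only [matPairing, matAct, Matrix.mul_apply, Fintype.sum_prod_type, Matrix.one_apply,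
        Matrix.of_apply, Matrix.kroneckerMap_apply, _root_.sum_apply,
        _root_.smul_apply, smul_eq_mul, mul_ite, ite_mul, mul_one, mul_zero, zero_mul,
        Finset.sum_ite_eq, Finset.sum_ite_eq', Finset.mem_univ, if_true, Finset.sum_mul]
      rw [Finset.sum_comm]
      exact Finset.sum_congr rfl fun _ _ => Finset.sum_congr rfl fun _ _ => by ring
    rw [e]
    refine (Matrix.l2_opNorm_mul _ _).trans ?_
    refine mul_le_mul ((Matrix.l2_opNorm_mul _ _).trans ?_) (norm_kronecker_one_le _)
      (norm_nonneg _) (mul_nonneg (norm_nonneg _) (dualMatNorm_nonneg _))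
    exact mul_le_mul (norm_kronecker_one_le _) (norm_matPairing_le_of_le_one f hx)
      (norm_nonneg _) (norm_nonneg _)

end Constructions

section Maps

variable {V W : Type*} [NormedAddCommGroup V] [NormedSpace ℂ V] [OperatorSpace V]
  [NormedAddCommGroup W] [NormedSpace ℂ W] [OperatorSpace W]

/-- The completely bounded norm `‖T‖_cb = sup_n ‖T_n‖` of a linear map, where
`T_n : M_n(V) → M_n(W)` is `T` applied to every entry; it is `∞` when `T` is not completely
bounded. -/
noncomputable def cbNorm (T : V →ₗ[ℂ] W) : ℝ≥0∞ :=
  ⨆ (n : ℕ) (x : Matrix (Fin n) (Fin n) V) (_ : matNorm n x ≤ 1),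
    ENNReal.ofReal (matNorm n (x.map T))

variable (V W) in
/-- The space `CB(V, W)` of completely bounded maps. -/
def CB : Set (V →ₗ[ℂ] W) := {T | cbNorm T < ∞}

/-- `T` is completely compact: for each `ε > 0` there is a finite-dimensional subspace `Y` of `W`
such that `‖Q_Y T‖_cb < ε`, where `Q_Y : W → W/Y` is the quotient map. -/
def IsCompletelyCompact (T : V →ₗ[ℂ] W) : Prop :=
  T ∈ CB V W ∧ ∀ ε : ℝ, 0 < ε → ∃ (Y : Submodule ℂ W) (_ : IsClosed (Y : Set W)),
    FiniteDimensional ℂ Y ∧ cbNorm (Y.mkQ ∘ₗ T) < ENNReal.ofReal ε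

/-- `T` is Gelfand completely compact: for each `ε > 0` there is a closed subspace `X` of `V` of
finite codimension such that `‖T|_X‖_cb < ε`. -/
def IsGelfandCompletelyCompact (T : V →ₗ[ℂ] W) : Prop :=
  T ∈ CB V W ∧ ∀ ε : ℝ, 0 < ε → ∃ X : Submodule ℂ V, IsClosed (X : Set V) ∧
    FiniteDimensional ℂ (V ⧸ X) ∧ cbNorm (T ∘ₗ X.subtype) < ENNReal.ofReal ε

/-- `T` is the limit in the cb-norm of a sequence of completely bounded maps of finite rank. -/
def IsCBLimitOfFiniteRank (T : V →ₗ[ℂ] W) : Prop :=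
  ∃ S : ℕ → V →ₗ[ℂ] W, (∀ k, S k ∈ CB V W ∧ FiniteDimensional ℂ (LinearMap.range (S k))) ∧
    Filter.Tendsto (fun k => cbNorm (S k - T)) Filter.atTop (𝓝 0)

/-- An operator space `Z` is injective if every completely bounded map into `Z` from a subspace of
an operator space `A` extends to `A` with the same cb-norm. -/
def IsInjective (Z : Type u) [NormedAddCommGroup Z] [NormedSpace ℂ Z] [OperatorSpace Z] : Prop :=
  ∀ (A : Type u) [NormedAddCommGroup A] [NormedSpace ℂ A] [OperatorSpace A]
    (B : Submodule ℂ A) (φ : B →ₗ[ℂ] Z), φ ∈ CB B Z →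
    ∃ ψ : A →ₗ[ℂ] Z, ψ ∘ₗ B.subtype = φ ∧ cbNorm ψ = cbNorm φ

end Maps

end OperatorSpace

/-!
Finite rank approximation of `T` gives both compactness properties at once: if `S` has finite rank
and is close to `T`, then `Q_Y T = Q_Y (T - S)` for `Y = range S`, and `T|_X = (T - S)|_X` for
`X = ker S`.

Conversely, if `T|_X` is small and `F*` is injective, `T|_X` extends to a small `R : E → F*`, and
`T - R` vanishes on `X`, so it has finite rank (`IsGelfandCompletelyCompact.isCBLimitOfFiniteRank`).

If instead `Q_Y T` is small, one passes to the transpose `Tᵗ : F → E*`, `Tᵗ f e = T e f`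
(`flipDual`). Transposition does not increase the cb-norm, because both cb-norms are suprema of
`‖[T x_ij (y_kl)]‖` over the unit balls of the `M_m(E)` and `M_n(F)`. On the preannihilator `X` of
`Y` in `F` the pairing with `T x` depends only on `Q_Y (T x)`, so `Tᵗ|_X` is small
(`cbNorm_flipDual_comp_subtype_le`). By injectivity of `E*` it extends to a small
`R : F → E*`, and `T - Rᵗ` takes values in the annihilator of `X`, which is the finite-dimensional space `Y`
(`IsCompletelyCompact.isCBLimitOfFiniteRank`).
-/

namespace OperatorSpace

/-! ### Completely bounded maps -/

section CBNorm

variable {V W : Type*} [NormedAddCommGroup V] [NormedSpace ℂ V] [OperatorSpace V]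
  [NormedAddCommGroup W] [NormedSpace ℂ W] [OperatorSpace W]

theorem cbNorm_le_ofReal {T : V →ₗ[ℂ] W} {C : ℝ}
    (h : ∀ (n : ℕ) (x : Matrix (Fin n) (Fin n) V), matNorm n x ≤ 1 → matNorm n (x.map T) ≤ C) :
    cbNorm T ≤ ENNReal.ofReal C :=
  iSup_le fun n => iSup_le fun x => iSup_le fun hx => ENNReal.ofReal_le_ofReal (h n x hx)

theorem ofReal_matNorm_map_le (T : V →ₗ[ℂ] W) {n : ℕ} {x : Matrix (Fin n) (Fin n) V}
    (hx : matNorm n x ≤ 1) : ENNReal.ofReal (matNorm n (x.map T)) ≤ cbNorm T :=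
  le_iSup_of_le n (le_iSup_of_le x (le_iSup_of_le hx le_rfl))

theorem matNorm_map_le_of_le_one {T : V →ₗ[ℂ] W} (hT : cbNorm T < ∞) {n : ℕ}
    {x : Matrix (Fin n) (Fin n) V} (hx : matNorm n x ≤ 1) :
    matNorm n (x.map T) ≤ (cbNorm T).toReal :=
  (ENNReal.ofReal_le_iff_le_toReal hT.ne).1 (ofReal_matNorm_map_le T hx)

theorem norm_le_cbNorm {T : V →ₗ[ℂ] W} (hT : cbNorm T < ∞) (v : V) :
    ‖T v‖ ≤ (cbNorm T).toReal * ‖v‖ := by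
  rcases eq_or_ne v 0 with rfl | hv
  · simp
  have hv' : 0 < ‖v‖ := norm_pos_iff.mpr hv
  have hx : matNorm 1 (Matrix.of fun (_ _ : Fin 1) => ((‖v‖⁻¹ : ℝ) : ℂ) • v) ≤ 1 := by
    rw [matNorm_one (((‖v‖⁻¹ : ℝ) : ℂ) • v), norm_smul, Complex.norm_real, norm_inv, norm_norm,
      inv_mul_cancel₀ hv'.ne']
  have h : matNorm 1 (Matrix.of fun (_ _ : Fin 1) => T (((‖v‖⁻¹ : ℝ) : ℂ) • v)) ≤ _ :=
    matNorm_map_le_of_le_one hT hx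
  rw [matNorm_one (T (((‖v‖⁻¹ : ℝ) : ℂ) • v)), map_smul, norm_smul, Complex.norm_real, norm_inv,
    norm_norm] at h
  rwa [inv_mul_le_iff₀ hv', mul_comm] at h

theorem continuous_of_mem_CB {T : V →ₗ[ℂ] W} (hT : T ∈ CB V W) : Continuous T :=
  AddMonoidHomClass.continuous_of_bound T _ (norm_le_cbNorm hT)

theorem cbNorm_neg (T : V →ₗ[ℂ] W) : cbNorm (-T) = cbNorm T := by
  unfold cbNorm
  have h (n : ℕ) (x : Matrix (Fin n) (Fin n) V) : x.map (-T) = -x.map T := rfl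
  simp only [h, map_neg_eq_map]

theorem cbNorm_add_le (S T : V →ₗ[ℂ] W) : cbNorm (S + T) ≤ cbNorm S + cbNorm T := by
  refine iSup_le fun n => iSup_le fun x => iSup_le fun hx => ?_
  have h : x.map (S + T) = x.map S + x.map T := rfl
  rw [h]
  refine (ENNReal.ofReal_le_ofReal (map_add_le_add (matNorm n) _ _)).trans ?_
  exact ENNReal.ofReal_add_le.trans
    (add_le_add (ofReal_matNorm_map_le S hx) (ofReal_matNorm_map_le T hx))

theorem sub_mem_CB {S T : V →ₗ[ℂ] W} (hS : S ∈ CB V W) (hT : T ∈ CB V W) : S - T ∈ CB V W := by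
  rw [sub_eq_add_neg]
  refine (cbNorm_add_le _ _).trans_lt ?_
  rw [cbNorm_neg]
  exact ENNReal.add_lt_top.2 ⟨hS, hT⟩

theorem cbNorm_comp_subtype_le (T : V →ₗ[ℂ] W) (X : Submodule ℂ V) :
    cbNorm (T ∘ₗ X.subtype) ≤ cbNorm T :=
  iSup_le fun _ => iSup_le fun x => iSup_le fun hx =>
    ofReal_matNorm_map_le T (x := x.map X.subtype) hx

theorem cbNorm_mkQ_comp_le (T : V →ₗ[ℂ] W) (Y : Submodule ℂ W) [IsClosed (Y : Set W)] :
    cbNorm (Y.mkQ ∘ₗ T) ≤ cbNorm T :=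
  iSup_le fun _ => iSup_le fun x => iSup_le fun hx =>
    (ENNReal.ofReal_le_ofReal (quotMatNorm_le Y (x.map T))).trans (ofReal_matNorm_map_le T hx)

end CBNorm

/-! ### Finite rank approximation -/

theorem finiteDimensional_range_of_comp_subtype_eq_zero {V W : Type*}
    [AddCommGroup V] [Module ℂ V] [AddCommGroup W] [Module ℂ W]
    {S : V →ₗ[ℂ] W} {X : Submodule ℂ V} [FiniteDimensional ℂ (V ⧸ X)] (h : S ∘ₗ X.subtype = 0) :
    FiniteDimensional ℂ (LinearMap.range S) := by
  have hX : X ≤ LinearMap.ker S := fun x hx => LinearMap.congr_fun h ⟨x, hx⟩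
  rw [← X.range_liftQ S hX]
  infer_instance

section FiniteRank

variable {V W : Type*} [NormedAddCommGroup V] [NormedSpace ℂ V] [OperatorSpace V]
  [NormedAddCommGroup W] [NormedSpace ℂ W] [OperatorSpace W] {T : V →ₗ[ℂ] W}

theorem IsCBLimitOfFiniteRank.exists_lt (h : IsCBLimitOfFiniteRank T) {ε : ℝ} (hε : 0 < ε) :
    ∃ S ∈ CB V W, FiniteDimensional ℂ (LinearMap.range S) ∧
      cbNorm (T - S) < ENNReal.ofReal ε := by
  obtain ⟨S, hS, hlim⟩ := h
  obtain ⟨k, hk⟩ := (hlim.eventually_lt_const (ENNReal.ofReal_pos.2 hε)).exists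
  exact ⟨S k, (hS k).1, (hS k).2, by rwa [← neg_sub, cbNorm_neg]⟩

/-- It suffices to write `T`, for each `ε > 0`, as a finite rank map plus a map `R` of cb-norm less
than `ε`. -/
theorem isCBLimitOfFiniteRank_of_forall (hT : T ∈ CB V W)
    (h : ∀ ε : ℝ, 0 < ε → ∃ R : V →ₗ[ℂ] W, cbNorm R < ENNReal.ofReal ε ∧
      FiniteDimensional ℂ (LinearMap.range (T - R))) : IsCBLimitOfFiniteRank T := by
  choose R hR hfin using fun k : ℕ => h (1 / ((k : ℝ) + 1)) (by positivity)
  refine ⟨fun k => T - R k, fun k => ⟨sub_mem_CB hT ((hR k).trans ENNReal.ofReal_lt_top), hfin k⟩,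
    ?_⟩
  have h0 : Filter.Tendsto (fun k : ℕ => ENNReal.ofReal (1 / ((k : ℝ) + 1))) Filter.atTop (𝓝 0) := by
    simpa using ENNReal.tendsto_ofReal (tendsto_one_div_add_atTop_nhds_zero_nat (𝕜 := ℝ))
  refine tendsto_of_tendsto_of_tendsto_of_le_of_le tendsto_const_nhds h0 (fun _ => zero_le)
    fun k => ?_
  simpa [cbNorm_neg] using (hR k).le

theorem IsCBLimitOfFiniteRank.isCompletelyCompact (hT : T ∈ CB V W)
    (h : IsCBLimitOfFiniteRank T) : IsCompletelyCompact T := by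
  refine ⟨hT, fun ε hε => ?_⟩
  obtain ⟨S, -, hfin, hlt⟩ := h.exists_lt hε
  have hcl : IsClosed (LinearMap.range S : Set W) := Submodule.closed_of_finiteDimensional _
  refine ⟨LinearMap.range S, hcl, hfin, ?_⟩
  have e : (LinearMap.range S).mkQ ∘ₗ T = (LinearMap.range S).mkQ ∘ₗ (T - S) := by
    rw [LinearMap.comp_sub, LinearMap.range_mkQ_comp, sub_zero]
  rw [e]
  exact (cbNorm_mkQ_comp_le _ _).trans_lt hlt

theorem IsCBLimitOfFiniteRank.isGelfandCompletelyCompact (hT : T ∈ CB V W)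
    (h : IsCBLimitOfFiniteRank T) : IsGelfandCompletelyCompact T := by
  refine ⟨hT, fun ε hε => ?_⟩
  obtain ⟨S, hS, hfin, hlt⟩ := h.exists_lt hε
  refine ⟨LinearMap.ker S, isClosed_singleton.preimage (continuous_of_mem_CB hS),
    Module.Finite.equiv S.quotKerEquivRange.symm, ?_⟩
  have e : T ∘ₗ (LinearMap.ker S).subtype = (T - S) ∘ₗ (LinearMap.ker S).subtype := by
    rw [LinearMap.sub_comp, LinearMap.comp_ker_subtype, sub_zero]
  rw [e]
  exact (cbNorm_comp_subtype_le _ _).trans_lt hlt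

end FiniteRank

theorem IsGelfandCompletelyCompact.isCBLimitOfFiniteRank {V W : Type u}
    [NormedAddCommGroup V] [NormedSpace ℂ V] [OperatorSpace V]
    [NormedAddCommGroup W] [NormedSpace ℂ W] [OperatorSpace W] {T : V →ₗ[ℂ] W}
    (hW : IsInjective W) (h : IsGelfandCompletelyCompact T) : IsCBLimitOfFiniteRank T := by
  refine isCBLimitOfFiniteRank_of_forall h.1 fun ε hε => ?_
  obtain ⟨X, -, hfin, hlt⟩ := h.2 ε hε
  obtain ⟨R, hRX, hR⟩ := hW V X (T ∘ₗ X.subtype) (hlt.trans ENNReal.ofReal_lt_top)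
  refine ⟨R, hR ▸ hlt, finiteDimensional_range_of_comp_subtype_eq_zero (X := X) ?_⟩
  rw [LinearMap.sub_comp, hRX, sub_self]

/-! ### Transposition of maps into a dual -/

section Flip

variable {E F : Type*} [NormedAddCommGroup E] [NormedSpace ℂ E] [OperatorSpace E]
  [NormedAddCommGroup F] [NormedSpace ℂ F] [OperatorSpace F]

/-- The transpose `F → E*`, `f ↦ (e ↦ T e f)`, of a completely bounded map `T : E → F*`. -/
noncomputable def flipDual (T : E →ₗ[ℂ] StrongDual ℂ F) (hT : T ∈ CB E (StrongDual ℂ F)) :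
    F →ₗ[ℂ] StrongDual ℂ E :=
  (ContinuousLinearMap.flip ⟨T, continuous_of_mem_CB hT⟩ : F →L[ℂ] StrongDual ℂ E)

theorem norm_submatrix_equiv_le {m n : Type*} [Fintype m] [Fintype n] [DecidableEq m]
    [DecidableEq n] (A : Matrix m m ℂ) (e : n ≃ m) : ‖A.submatrix e e‖ ≤ ‖A‖ := by
  refine l2_le (norm_nonneg _) fun v => ?_
  rw [Matrix.submatrix_mulVec_equiv, ← e.symm.sum_comp fun j => ‖v j‖ ^ 2]
  refine le_trans (le_of_eq ?_) (l2_sum_le A (v ∘ e.symm))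
  exact e.sum_comp fun i => ‖(A *ᵥ (v ∘ e.symm)) i‖ ^ 2

/-- If, modulo the annihilator of the entries of `y`, every `T x` with `‖x‖ ≤ 1` is represented by
a matrix of functionals of norm at most `C`, then the transpose of `T` maps `y` to a matrix of norm
at most `C`. -/
theorem matNorm_map_flipDual_le {T : E →ₗ[ℂ] StrongDual ℂ F} (hT : T ∈ CB E (StrongDual ℂ F))
    {C : ℝ} {n : ℕ} {y : Matrix (Fin n) (Fin n) F} (hy : matNorm n y ≤ 1)
    (h : ∀ (m : ℕ) (x : Matrix (Fin m) (Fin m) E), matNorm m x ≤ 1 →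
      ∃ z : Matrix (Fin m) (Fin m) (StrongDual ℂ F), matNorm m z ≤ C ∧
        ∀ i j k l, z i j (y k l) = T (x i j) (y k l)) :
    matNorm n (y.map (flipDual T hT)) ≤ C := by
  refine dualMatNorm_le _ fun m x hx => ?_
  obtain ⟨z, hz, hzy⟩ := h m x hx
  have e : matPairing (y.map (flipDual T hT)) x
      = (matPairing z y).submatrix (Equiv.prodComm _ _) (Equiv.prodComm _ _) := by
    ext ⟨k, i⟩ ⟨l, j⟩
    exact (hzy i j k l).symm
  rw [e]
  exact (norm_submatrix_equiv_le _ _).trans ((norm_matPairing_le_of_le_one z hy).trans hz)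

theorem cbNorm_flipDual_le {T : E →ₗ[ℂ] StrongDual ℂ F} (hT : T ∈ CB E (StrongDual ℂ F)) :
    cbNorm (flipDual T hT) ≤ cbNorm T := by
  rw [← ENNReal.ofReal_toReal (ne_of_lt hT)]
  exact cbNorm_le_ofReal fun n y hy => matNorm_map_flipDual_le hT hy fun m x hx =>
    ⟨x.map T, matNorm_map_le_of_le_one hT hx, fun _ _ _ _ => rfl⟩

end Flip

/-! ### Preannihilators -/

section Preannihilator

variable {F : Type*} [NormedAddCommGroup F] [NormedSpace ℂ F]

/-- The preannihilator of a space of functionals. -/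
noncomputable def preannihilator (Y : Submodule ℂ (StrongDual ℂ F)) : Submodule ℂ F :=
  (Y.map (ContinuousLinearMap.coeLM ℂ)).dualCoannihilator

theorem apply_eq_zero_of_mem_preannihilator {Y : Submodule ℂ (StrongDual ℂ F)} {f : StrongDual ℂ F}
    (hf : f ∈ Y) {y : F} (hy : y ∈ preannihilator Y) : f y = 0 :=
  (Submodule.mem_dualCoannihilator y).1 hy _ (Submodule.mem_map_of_mem hf)

/-- A finite-dimensional space of functionals is the annihilator of its preannihilator. -/
theorem mem_of_forall_mem_preannihilator {Y : Submodule ℂ (StrongDual ℂ F)}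
    [FiniteDimensional ℂ Y] {f : StrongDual ℂ F} (hf : ∀ y ∈ preannihilator Y, f y = 0) :
    f ∈ Y := by
  have h : (f : F →ₗ[ℂ] ℂ) ∈ (preannihilator Y).dualAnnihilator :=
    (Submodule.mem_dualAnnihilator _).2 hf
  rw [preannihilator, Subspace.dualCoannihilator_dualAnnihilator_eq] at h
  obtain ⟨g, hg, hgf⟩ := h
  rwa [← ContinuousLinearMap.coe_injective hgf]

end Preannihilator

/-- The transpose of `T` is at most as large on the preannihilator of `Y` as `T` is modulo `Y`. -/
theorem cbNorm_flipDual_comp_subtype_le {E F : Type*}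
    [NormedAddCommGroup E] [NormedSpace ℂ E] [OperatorSpace E]
    [NormedAddCommGroup F] [NormedSpace ℂ F] [OperatorSpace F] {T : E →ₗ[ℂ] StrongDual ℂ F}
    (hT : T ∈ CB E (StrongDual ℂ F)) (Y : Submodule ℂ (StrongDual ℂ F))
    [IsClosed (Y : Set (StrongDual ℂ F))] :
    cbNorm (flipDual T hT ∘ₗ (preannihilator Y).subtype) ≤
      cbNorm (W := StrongDual ℂ F ⧸ Y) (Y.mkQ ∘ₗ T) := by
  have hQ : cbNorm (W := StrongDual ℂ F ⧸ Y) (Y.mkQ ∘ₗ T) < ∞ :=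
    (cbNorm_mkQ_comp_le T Y).trans_lt hT
  rw [← ENNReal.ofReal_toReal hQ.ne]
  refine cbNorm_le_ofReal fun n y hy => le_of_forall_pos_le_add fun ε hε => ?_
  refine matNorm_map_flipDual_le hT (y := y.map (preannihilator Y).subtype) hy fun m x hx => ?_
  -- A lift `z` of `Q_Y (T x)` has the same pairing with `y` as `T x`, and almost the norm of
  -- `Q_Y (T x)`.
  obtain ⟨z, hz, hlt⟩ := exists_lift_lt Y (x.map (Y.mkQ ∘ₗ T)) hε
  refine ⟨z, hlt.le.trans ?_, fun i j k l => ?_⟩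
  · gcongr
    exact matNorm_map_le_of_le_one hQ hx
  · have hij : Y.mkQ (z i j) = Y.mkQ (T (x i j)) := congrFun (congrFun hz i) j
    exact sub_eq_zero.1 (apply_eq_zero_of_mem_preannihilator
      ((Submodule.Quotient.eq Y).1 hij) (y k l).2)

theorem IsCompletelyCompact.isCBLimitOfFiniteRank {E F : Type u}
    [NormedAddCommGroup E] [NormedSpace ℂ E] [OperatorSpace E]
    [NormedAddCommGroup F] [NormedSpace ℂ F] [OperatorSpace F] {T : E →ₗ[ℂ] StrongDual ℂ F}
    (hE : IsInjective (StrongDual ℂ E)) (h : IsCompletelyCompact T) :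
    IsCBLimitOfFiniteRank T := by
  have hT := h.1
  refine isCBLimitOfFiniteRank_of_forall hT fun ε hε => ?_
  obtain ⟨Y, hcl, hfin, hlt⟩ := h.2 ε hε
  have hX := (cbNorm_flipDual_comp_subtype_le hT Y).trans_lt hlt
  obtain ⟨R, hRX, hR⟩ := hE F (preannihilator Y)
    (flipDual T hT ∘ₗ (preannihilator Y).subtype) (hX.trans ENNReal.ofReal_lt_top)
  have hRlt : cbNorm R < ENNReal.ofReal ε := hR ▸ hX
  have hRcb : R ∈ CB F (StrongDual ℂ E) := hRlt.trans ENNReal.ofReal_lt_top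
  refine ⟨flipDual R hRcb, (cbNorm_flipDual_le hRcb).trans_lt hRlt, ?_⟩
  -- `T e - Rᵗ e` annihilates the preannihilator of `Y`, as `R` extends a restriction of `Tᵗ`.
  have hle : LinearMap.range (T - flipDual R hRcb) ≤ Y := by
    rintro _ ⟨e, rfl⟩
    refine mem_of_forall_mem_preannihilator fun y hy => ?_
    have hy' : R y e = T e y := congrArg (fun g : StrongDual ℂ E => g e)
      (LinearMap.congr_fun hRX ⟨y, hy⟩)
    exact sub_eq_zero.2 hy'.symm
  exact Submodule.finiteDimensional_of_le hle

end OperatorSpace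

theorem mainTheorem3 {E F : Type u}
    [NormedAddCommGroup E] [NormedSpace ℂ E] [OperatorSpace E]
    [NormedAddCommGroup F] [NormedSpace ℂ F] [OperatorSpace F]
    (hE : OperatorSpace.IsInjective (StrongDual ℂ E))
    (hF : OperatorSpace.IsInjective (StrongDual ℂ F))
    (T : E →ₗ[ℂ] StrongDual ℂ F) (hT : T ∈ OperatorSpace.CB E (StrongDual ℂ F)) :
    List.TFAE [OperatorSpace.IsCompletelyCompact T,
      OperatorSpace.IsGelfandCompletelyCompact T,
      OperatorSpace.IsCBLimitOfFiniteRank T] := by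
  tfae_have 1 → 3 := fun h => h.isCBLimitOfFiniteRank hE
  tfae_have 2 → 3 := fun h => h.isCBLimitOfFiniteRank hF
  tfae_have 3 → 1 := fun h => h.isCompletelyCompact hT
  tfae_have 3 → 2 := fun h => h.isGelfandCompletelyCompact hT
  tfae_finish
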